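/- Let $n\ge 1$, $0<\gamma<n$, $q=n/(n-\gamma)$, and let $v(x)=|x|^{\beta}$ on $\mathbb{R}^n$ with $\beta<-n$. Let $u\in A_1$, that is, $u$ is a locally integrable function on $\mathbb{R}^n$ with $0<u(x)<\infty$ for almost every $x$, and there is a constant $C_0>0$ such that \[\frac{1}{|Q|}\int_Q u\le C_0\,\operatorname*{ess\,inf}_Q u\] for every cube $Q\subset\mathbb{R}^n$ with sides parallel to the coordinate axes. Let $M_\gamma$ be the fractional maximal operator \[M_\gamma g(x)=\sup_{Q\ni x}|Q|^{\gamma/n}\,\frac{1}{|Q|}\int_Q|g(y)|\,dy,\] where the supremum is taken over all such cubes $Q$ containing $x$, and write $uv^q(E)=\int_E u(x)v(x)^q\,dx$. Then there exists a constant $C>0$ such that \[uv^q\left(\left\{x\in\mathbb{R}^n:\frac{M_\gamma(fv)(x)}{v(x)}>t\right\}\right)^{1/q}\le\frac{C}{t}\int_{\mathbb{R}^n}|f(x)|\,u^{1/q}(x)\,v(x)\,dx\] for every $t>0$ and every (essentially) bounded measurable function $f$, where both sides are allowed to be $+\infty$. -/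

import Mathlib

open MeasureTheory
open scoped ENNReal NNReal

noncomputable section

/-- The closed cube in `ℝⁿ` with sides parallel to the coordinate axes, lower corner `a` and
side length `l`. -/
def cube {n : ℕ} (a : EuclideanSpace ℝ (Fin n)) (l : ℝ) : Set (EuclideanSpace ℝ (Fin n)) :=
  {x | ∀ i, a i ≤ x i ∧ x i ≤ a i + l}

/-- A weight: a locally integrable function with `0 < w x < ∞` for almost every `x`
(finiteness is built into the real-valued codomain). -/
def IsWeight {n : ℕ} (w : EuclideanSpace ℝ (Fin n) → ℝ) : Prop :=
  LocallyIntegrable w volume ∧ ∀ᵐ x ∂(volume : Measure (EuclideanSpace ℝ (Fin n))), 0 < w x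

/-- The Muckenhoupt class `A₁`: weights whose average over every cube is at most a fixed
constant times the essential infimum over that cube. -/
def IsA1 {n : ℕ} (w : EuclideanSpace ℝ (Fin n) → ℝ) : Prop :=
  IsWeight w ∧ ∃ C : ℝ≥0, 0 < C ∧ ∀ (a : EuclideanSpace ℝ (Fin n)) (l : ℝ), 0 < l →
    (⨍⁻ y in cube a l, ENNReal.ofReal (w y) ∂volume) ≤
      (C : ℝ≥0∞) * essInf (fun y => ENNReal.ofReal (w y)) (volume.restrict (cube a l))

/-- The fractional maximal operator
`M_γ f (x) = sup_{Q ∋ x} |Q|^{γ/n} (1/|Q|) ∫_Q |f|`, the supremum over all cubes containing `x`,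
as an extended nonnegative real number. -/
def fractionalMaximal {n : ℕ} (γ : ℝ) (f : EuclideanSpace ℝ (Fin n) → ℝ)
    (x : EuclideanSpace ℝ (Fin n)) : ℝ≥0∞ :=
  ⨆ (a : EuclideanSpace ℝ (Fin n)) (l : ℝ) (_ : 0 < l) (_ : x ∈ cube a l),
    volume (cube a l) ^ (γ / (n : ℝ)) * ⨍⁻ y in cube a l, ENNReal.ofReal |f y| ∂volume

/-- The radial power `v x = |x|^β`. For `β < 0` its value at the origin is a convention, which
plays no role since points are null sets in positive dimension. -/
def radialPower {n : ℕ} (β : ℝ) (x : EuclideanSpace ℝ (Fin n)) : ℝ := ‖x‖ ^ β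

end

/-! Put G = |f|v and δ = γ/n, so that δq = q - 1 and |Q| times the q-th power of the fractional
average of G over Q is (∫_Q G)^q. For a cube Q' ⊇ Q of comparable size, A₁ bounds u(Q') by |Q| times
the essential infimum of u, which can be moved inside the integral as u^{1/q}; this is
`A1Bound.lintegral_mul_le`. Each x ≠ 0 in the level set has a witness cube Q ∋ x, of side l, whose
fractional average exceeds t·v(x). If l is small compared with |x|, then v is at most a constant
times v(x) on the fivefold enlargement of Q, and a Vitali covering together with ℓ¹ ⊆ ℓ^q finishes
(`A1Bound.lintegral_local_le`). If l is large, no covering is needed: since βq < -n, the uv^q-mass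
of the whole region outside radius about |x| is at most a constant times v(x)^q times the u-mass of
a cube at scale |x| (`A1Bound.lintegral_tail_le`), and this is controlled through the single cube Q.
The bound is uniform as |x| varies over the level set (`A1Bound.lintegral_global_le`). -/

/-! ### Geometry and measure of cubes. -/

theorem cube_eq_preimage_Icc {n : ℕ} (a : EuclideanSpace ℝ (Fin n)) (l : ℝ) :
    cube a l = WithLp.ofLp ⁻¹' Set.Icc a.ofLp (fun i => a i + l) := by
  ext x
  simp only [cube, Set.mem_ofPred_eq, Set.mem_preimage, Set.mem_Icc, Pi.le_def]
  exact forall_and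

theorem measurableSet_cube {n : ℕ} (a : EuclideanSpace ℝ (Fin n)) (l : ℝ) :
    MeasurableSet (cube a l) := by
  rw [cube_eq_preimage_Icc]
  exact (PiLp.volume_preserving_ofLp (Fin n)).measurable measurableSet_Icc

theorem volume_cube {n : ℕ} (a : EuclideanSpace ℝ (Fin n)) (l : ℝ) :
    volume (cube a l) = ENNReal.ofReal l ^ n := by
  rw [cube_eq_preimage_Icc, (PiLp.volume_preserving_ofLp (Fin n)).measure_preimage
    measurableSet_Icc.nullMeasurableSet, Real.volume_Icc_pi]
  simp

theorem volume_cube_ne_zero {n : ℕ} (a : EuclideanSpace ℝ (Fin n)) {l : ℝ} (hl : 0 < l) :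
    volume (cube a l) ≠ 0 := by
  rw [volume_cube]
  exact pow_ne_zero _ (by simpa using hl)

theorem volume_cube_ne_top {n : ℕ} (a : EuclideanSpace ℝ (Fin n)) (l : ℝ) :
    volume (cube a l) ≠ ∞ := by
  rw [volume_cube]
  exact ENNReal.pow_ne_top ENNReal.ofReal_ne_top

theorem interior_cube_nonempty {n : ℕ} (a : EuclideanSpace ℝ (Fin n)) {l : ℝ} (hl : 0 < l) :
    (interior (cube a l)).Nonempty := by
  rw [Set.nonempty_iff_ne_empty]
  intro h
  have ho : IsOpen {x : EuclideanSpace ℝ (Fin n) | ∀ i, a i < x i ∧ x i < a i + l} := by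
    simp only [Set.ofPred_forall]
    refine isOpen_iInter_of_finite fun i => ?_
    have hc : Continuous fun x : EuclideanSpace ℝ (Fin n) => x i := by fun_prop
    exact (isOpen_lt continuous_const hc).inter (isOpen_lt hc continuous_const)
  have hs := interior_maximal (s := cube a l) (fun x hx i => ⟨(hx i).1.le, (hx i).2.le⟩) ho
  rw [h] at hs
  refine hs (a := WithLp.toLp 2 fun i => a i + l / 2) fun i => ?_
  constructor <;> simp <;> linarith

theorem norm_sub_le_of_mem_cube {n : ℕ} {a x y : EuclideanSpace ℝ (Fin n)} {l : ℝ}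
    (hx : x ∈ cube a l) (hy : y ∈ cube a l) : ‖x - y‖ ≤ n * l := by
  have h : ‖x - y‖ ≤ ∑ i, |x i - y i| := by
    rw [EuclideanSpace.norm_eq]
    refine Real.sqrt_le_iff.2 ⟨by positivity, ?_⟩
    exact Finset.sum_sq_le_sq_sum_of_nonneg (s := Finset.univ) (f := fun i => |x i - y i|)
      fun i _ => abs_nonneg _
  refine h.trans ((Finset.sum_le_card_nsmul _ _ l fun i _ => ?_).trans (by simp))
  have := hx i
  have := hy i
  rw [abs_le]
  constructor <;> linarith

/-! ### `A₁` weights on nested cubes. -/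

/-- The `A₁` condition in multiplicative form, for an extended nonnegative weight. -/
def A1Bound {n : ℕ} (U : EuclideanSpace ℝ (Fin n) → ℝ≥0∞) (C : ℝ≥0∞) : Prop :=
  ∀ (a : EuclideanSpace ℝ (Fin n)) (l : ℝ), 0 < l →
    ∫⁻ y in cube a l, U y ≤ C * (volume (cube a l) * essInf U (volume.restrict (cube a l)))

theorem IsA1.exists_a1Bound {n : ℕ} {u : EuclideanSpace ℝ (Fin n) → ℝ} (hu : IsA1 u) :
    ∃ C : ℝ≥0, A1Bound (fun y => ENNReal.ofReal (u y)) C := by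
  obtain ⟨-, C, -, hC⟩ := hu
  refine ⟨C, fun a l hl => ?_⟩
  have h := hC a l hl
  rw [setLAverage_eq, ENNReal.div_le_iff (volume_cube_ne_zero a hl) (volume_cube_ne_top a l)] at h
  exact h.trans_eq (by ring)

theorem essInf_restrict_anti {n : ℕ} (U : EuclideanSpace ℝ (Fin n) → ℝ≥0∞)
    {s t : Set (EuclideanSpace ℝ (Fin n))} (h : s ⊆ t) :
    essInf U (volume.restrict t) ≤ essInf U (volume.restrict s) :=
  essInf_antitone_measure (Measure.absolutelyContinuous_of_le (Measure.restrict_mono h le_rfl))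

/-- The normalised fractional average of `G` over a cube, raised to the power `q`. -/
theorem fractional_average_rpow {n : ℕ} {δ q : ℝ} (hq : 0 < q) (hδ : δ * q = q - 1)
    (G : EuclideanSpace ℝ (Fin n) → ℝ≥0∞) (a : EuclideanSpace ℝ (Fin n)) {l : ℝ} (hl : 0 < l) :
    volume (cube a l) * (volume (cube a l) ^ δ * ⨍⁻ y in cube a l, G y ∂volume) ^ q =
      (∫⁻ y in cube a l, G y) ^ q := by
  have h0 := volume_cube_ne_zero a hl
  have h1 := volume_cube_ne_top a l
  rw [setLAverage_eq, ENNReal.div_eq_inv_mul, ← mul_assoc, ENNReal.mul_rpow_of_nonneg _ _ hq.le,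
    ← mul_assoc, ← ENNReal.rpow_neg_one, ← ENNReal.rpow_add _ _ h0 h1, ← ENNReal.rpow_mul]
  nth_rewrite 1 [← ENNReal.rpow_one (volume (cube a l))]
  rw [← ENNReal.rpow_add _ _ h0 h1]
  have : 1 + (δ + -1) * q = 0 := by linarith
  simp [this]

/-- The common engine of both cases. With m the essential infimum of U over the larger cube, A₁ and
the volume comparison give mass at most C·Kⁿ·|Q|·m; the factor |Q| turns the average into (∫_Q G)^q,
and m^{1/q} ≤ U^{1/q} a.e. on the smaller cube. -/
theorem A1Bound.lintegral_mul_le {n : ℕ} {U : EuclideanSpace ℝ (Fin n) → ℝ≥0∞} {C : ℝ≥0∞}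
    (hU : A1Bound U C) {δ q : ℝ} (hq : 0 < q) (hδ : δ * q = q - 1)
    (G : EuclideanSpace ℝ (Fin n) → ℝ≥0∞) {a b : EuclideanSpace ℝ (Fin n)} {l l' K : ℝ}
    (hl : 0 < l) (hl' : 0 < l') (hK : 0 ≤ K) (hsub : cube a l ⊆ cube b l') (hle : l' ≤ K * l) :
    (∫⁻ y in cube b l', U y) * (volume (cube a l) ^ δ * ⨍⁻ y in cube a l, G y ∂volume) ^ q ≤
      C * ENNReal.ofReal K ^ n * (∫⁻ y in cube a l, G y * U y ^ (1 / q)) ^ q := by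
  set m := essInf U (volume.restrict (cube b l'))
  have hvol : volume (cube b l') ≤ ENNReal.ofReal K ^ n * volume (cube a l) := by
    rw [volume_cube, volume_cube, ← mul_pow, ← ENNReal.ofReal_mul hK]
    gcongr
  have hm : m * (∫⁻ y in cube a l, G y) ^ q ≤ (∫⁻ y in cube a l, G y * U y ^ (1 / q)) ^ q := by
    have h1 : m = (m ^ (1 / q)) ^ q := by
      rw [← ENNReal.rpow_mul, one_div_mul_cancel hq.ne', ENNReal.rpow_one]
    rw [h1, ← ENNReal.mul_rpow_of_nonneg _ _ hq.le]
    -- Only this direction of pulling out a constant is used; it holds without measurability of `G`.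
    refine ENNReal.rpow_le_rpow ((lintegral_const_mul_le _ _).trans (lintegral_mono_ae ?_)) hq.le
    filter_upwards [ae_essInf_le (μ := volume.restrict (cube a l)) (f := U)] with y hy
    rw [mul_comm]
    gcongr
    exact (essInf_restrict_anti U hsub).trans hy
  calc (∫⁻ y in cube b l', U y) * (volume (cube a l) ^ δ * ⨍⁻ y in cube a l, G y ∂volume) ^ q
      ≤ (C * ((ENNReal.ofReal K ^ n * volume (cube a l)) * m)) *
          (volume (cube a l) ^ δ * ⨍⁻ y in cube a l, G y ∂volume) ^ q := by
        gcongr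
        exact (hU b l' hl').trans (by gcongr)
    _ = C * ENNReal.ofReal K ^ n * (m * (volume (cube a l) *
          (volume (cube a l) ^ δ * ⨍⁻ y in cube a l, G y ∂volume) ^ q)) := by ring
    _ ≤ _ := by
        rw [fractional_average_rpow hq hδ G a hl]
        gcongr

/-- Doubling for `A₁` weights on nested cubes. -/
theorem A1Bound.lintegral_cube_le {n : ℕ} {U : EuclideanSpace ℝ (Fin n) → ℝ≥0∞} {C : ℝ≥0∞}
    (hU : A1Bound U C) {a b : EuclideanSpace ℝ (Fin n)} {l l' K : ℝ}
    (hl : 0 < l) (hl' : 0 < l') (hK : 0 ≤ K) (hsub : cube a l ⊆ cube b l') (hle : l' ≤ K * l) :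
    ∫⁻ y in cube b l', U y ≤ C * ENNReal.ofReal K ^ n * ∫⁻ y in cube a l, U y := by
  have h0 := volume_cube_ne_zero a hl
  have h1 := volume_cube_ne_top a l
  have h := hU.lintegral_mul_le (δ := 0) one_pos (by norm_num) (fun _ => 1) hl hl' hK hsub hle
  simpa [setLAverage_eq, ENNReal.div_self h0 h1] using h

/-! ### Elementary inequalities for sums and weights. -/

/-- The embedding ℓ¹ ⊆ ℓ^q: in x^q = x·x^{q-1}, each x^{q-1} is at most the same power of the full
sum. -/
theorem tsum_rpow_le_rpow_tsum {ι : Type*} (f : ι → ℝ≥0∞) {q : ℝ} (hq : 1 ≤ q) :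
    ∑' i, f i ^ q ≤ (∑' i, f i) ^ q := by
  have key : ∀ x : ℝ≥0∞, x ^ q = x * x ^ (q - 1) := fun x => by
    conv_rhs => rw [← ENNReal.rpow_one x, ← ENNReal.rpow_mul, one_mul,
      ← ENNReal.rpow_add_of_nonneg _ _ zero_le_one (sub_nonneg.2 hq)]
    simp
  rw [key (∑' i, f i), ← ENNReal.tsum_mul_right]
  refine ENNReal.tsum_le_tsum fun i => ?_
  rw [key]
  exact mul_le_mul' le_rfl (ENNReal.rpow_le_rpow (ENNReal.le_tsum i) (sub_nonneg.2 hq))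

/-- Comparison of the radial power at radii that differ at most by a factor of two. -/
theorem ofReal_rpow_le_of_half_le {β s t : ℝ} (hβ : β ≤ 0) (ht : 0 < t) (hs : t / 2 ≤ s) :
    ENNReal.ofReal (s ^ β) ≤ ENNReal.ofReal (2 ^ (-β)) * ENNReal.ofReal (t ^ β) := by
  rw [← ENNReal.ofReal_mul (by positivity)]
  refine ENNReal.ofReal_le_ofReal ((Real.rpow_le_rpow_of_nonpos (by positivity) hs hβ).trans_eq ?_)
  rw [Real.div_rpow ht.le (by norm_num), Real.rpow_neg (by norm_num)]
  field_simp

theorem setLIntegral_mul_rpow_le {n : ℕ} (U V : EuclideanSpace ℝ (Fin n) → ℝ≥0∞)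
    {s S : Set (EuclideanSpace ℝ (Fin n))} (hs : MeasurableSet s) (hS : s ⊆ S) {c : ℝ≥0∞}
    (hc : c ≠ ∞) {q : ℝ} (hq : 0 ≤ q) (hV : ∀ y ∈ s, V y ≤ c) :
    ∫⁻ y in s, U y * V y ^ q ≤ c ^ q * ∫⁻ y in S, U y := by
  rw [← lintegral_const_mul' _ _ (ENNReal.rpow_ne_top_of_nonneg hq hc)]
  refine (setLIntegral_mono' hs fun y hy => ?_).trans (lintegral_mono_set hS)
  rw [mul_comm]
  gcongr
  exact hV y hy

/-! ### Cubes small relative to the distance to the origin. -/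

/-- The part of the level set covered by cubes that are small relative to the distance to `0`. -/
theorem A1Bound.lintegral_local_le {n : ℕ} (hn : 1 ≤ n) {U : EuclideanSpace ℝ (Fin n) → ℝ≥0∞}
    {C : ℝ≥0∞} (hU : A1Bound U C) {β δ q : ℝ} (hβ : β ≤ 0) (hq : 1 ≤ q) (hδ : δ * q = q - 1)
    (G : EuclideanSpace ℝ (Fin n) → ℝ≥0∞) (τ : ℝ≥0∞) :
    τ ^ q * ∫⁻ y in {x : EuclideanSpace ℝ (Fin n) | x ≠ 0 ∧ ∃ (a : EuclideanSpace ℝ (Fin n))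
        (l : ℝ), 0 < l ∧ x ∈ cube a l ∧ 10 * n * l ≤ ‖x‖ ∧
        τ * ENNReal.ofReal (‖x‖ ^ β) ≤ volume (cube a l) ^ δ * ⨍⁻ y in cube a l, G y ∂volume},
        U y * ENNReal.ofReal (‖y‖ ^ β) ^ q ≤
      ENNReal.ofReal (2 ^ (-β)) ^ q * (C * ENNReal.ofReal 5 ^ n) *
        (∫⁻ y, G y * U y ^ (1 / q)) ^ q := by
  have hq0 : 0 < q := by linarith
  have hn' : (1 : ℝ) ≤ n := by exact_mod_cast hn
  set V : EuclideanSpace ℝ (Fin n) → ℝ≥0∞ := fun y => ENNReal.ofReal (‖y‖ ^ β)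
  set D := ENNReal.ofReal ((2 : ℝ) ^ (-β)) with hD
  set P : EuclideanSpace ℝ (Fin n) × ℝ × EuclideanSpace ℝ (Fin n) → Prop := fun p =>
    p.2.2 ≠ 0 ∧ 0 < p.2.1 ∧ p.2.2 ∈ cube p.1 p.2.1 ∧ 10 * n * p.2.1 ≤ ‖p.2.2‖ ∧
      τ * V p.2.2 ≤ volume (cube p.1 p.2.1) ^ δ * ⨍⁻ y in cube p.1 p.2.1, G y ∂volume
  -- The concentric fivefold enlargement. Its diameter is at most 5nl ≤ ‖x‖/2, which is why the
  -- threshold is 10nl.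
  set five : EuclideanSpace ℝ (Fin n) × ℝ × EuclideanSpace ℝ (Fin n) →
    Set (EuclideanSpace ℝ (Fin n)) := fun p =>
      cube (WithLp.toLp 2 fun i => p.1 i - 2 * p.2.1) (5 * p.2.1)
  have hsub : ∀ p, P p → cube p.1 p.2.1 ⊆ five p := by
    rintro ⟨a, l, x⟩ ⟨-, hl, -⟩ y hy i
    have := hy i
    simp only at this hl ⊢
    constructor <;> linarith
  have single : ∀ p, P p → τ ^ q * ∫⁻ y in five p, U y * V y ^ q ≤
      D ^ q * (C * ENNReal.ofReal 5 ^ n) * (∫⁻ y in cube p.1 p.2.1, G y * U y ^ (1 / q)) ^ q := by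
    rintro p hp
    have hpsub := hsub p hp
    obtain ⟨hx0, hl, hx, hxl, hτ⟩ := hp
    have hnorm : 0 < ‖p.2.2‖ := norm_pos_iff.2 hx0
    have hV : ∀ y ∈ five p, V y ≤ D * V p.2.2 := by
      intro y hy
      refine ofReal_rpow_le_of_half_le hβ hnorm ?_
      have h1 := norm_sub_le_of_mem_cube (hpsub hx) hy
      have h2 := norm_sub_norm_le p.2.2 y
      linarith
    calc τ ^ q * ∫⁻ y in five p, U y * V y ^ q
        ≤ τ ^ q * ((D * V p.2.2) ^ q * ∫⁻ y in five p, U y) := by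
          gcongr
          exact setLIntegral_mul_rpow_le U V (measurableSet_cube _ _) subset_rfl
            (ENNReal.mul_ne_top ENNReal.ofReal_ne_top ENNReal.ofReal_ne_top) hq0.le hV
      _ = D ^ q * ((∫⁻ y in five p, U y) * (τ * V p.2.2) ^ q) := by
          rw [ENNReal.mul_rpow_of_nonneg _ _ hq0.le, ENNReal.mul_rpow_of_nonneg _ _ hq0.le]
          ring
      _ ≤ D ^ q * ((∫⁻ y in five p, U y) * (volume (cube p.1 p.2.1) ^ δ *
            ⨍⁻ y in cube p.1 p.2.1, G y ∂volume) ^ q) := by gcongr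
      _ ≤ D ^ q * (C * ENNReal.ofReal 5 ^ n *
            (∫⁻ y in cube p.1 p.2.1, G y * U y ^ (1 / q)) ^ q) := by
          refine mul_le_mul' le_rfl ?_
          exact hU.lintegral_mul_le hq0 hδ G hl (by positivity) (by norm_num) hpsub le_rfl
      _ = _ := by ring
  -- Vitali's lemma needs bounded side lengths; ‖x‖ ≤ R provides this through 10nl ≤ ‖x‖. The bound
  -- does not depend on R.
  have bounded : ∀ R : ℕ, τ ^ q * ∫⁻ y in {x | ‖x‖ ≤ R ∧ ∃ a l, P (a, l, x)}, U y * V y ^ q ≤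
      D ^ q * (C * ENNReal.ofReal 5 ^ n) * (∫⁻ y, G y * U y ^ (1 / q)) ^ q := by
    intro R
    obtain ⟨w, hw, hdisj, hcov⟩ := Vitali.exists_disjoint_subfamily_covering_enlargement
      (fun p : EuclideanSpace ℝ (Fin n) × ℝ × EuclideanSpace ℝ (Fin n) => cube p.1 p.2.1)
      {p | P p ∧ ‖p.2.2‖ ≤ R} (fun p => p.2.1) 2 (by norm_num) (fun p hp => hp.1.2.1.le) R
      (fun p hp => by
        have h1 := hp.1.2.1
        have h2 := hp.1.2.2.2.1
        have h3 := hp.2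
        nlinarith) (fun p hp => ⟨_, hp.1.2.2.1⟩)
    have hcount : w.Countable := hdisj.countable_of_nonempty_interior fun p hp =>
      interior_cube_nonempty _ (hw hp).1.2.1
    have : Countable w := hcount.to_subtype
    have hcover : {x | ‖x‖ ≤ R ∧ ∃ a l, P (a, l, x)} ⊆ ⋃ p : w, five p := by
      rintro x ⟨hxR, a, l, hx⟩
      obtain ⟨b, hb, ⟨z, hz, hz'⟩, hle⟩ := hcov (a, l, x) ⟨hx, hxR⟩
      refine Set.mem_iUnion.2 ⟨⟨b, hb⟩, fun i => ?_⟩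
      have h1 := hx.2.2.1 i
      have h2 := hz i
      have h3 := hz' i
      simp only at h1 h2 h3 hle ⊢
      constructor <;> linarith
    calc τ ^ q * ∫⁻ y in {x | ‖x‖ ≤ R ∧ ∃ a l, P (a, l, x)}, U y * V y ^ q
        ≤ τ ^ q * ∑' p : w, ∫⁻ y in five p, U y * V y ^ q := by
          gcongr
          exact (lintegral_mono_set hcover).trans (lintegral_iUnion_le _ _)
      _ = ∑' p : w, τ ^ q * ∫⁻ y in five p, U y * V y ^ q := ENNReal.tsum_mul_left.symm
      _ ≤ ∑' p : w, D ^ q * (C * ENNReal.ofReal 5 ^ n) *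
            (∫⁻ y in cube p.1.1 p.1.2.1, G y * U y ^ (1 / q)) ^ q :=
          ENNReal.tsum_le_tsum fun p => single p (hw p.2).1
      _ = D ^ q * (C * ENNReal.ofReal 5 ^ n) *
            ∑' p : w, (∫⁻ y in cube p.1.1 p.1.2.1, G y * U y ^ (1 / q)) ^ q :=
          ENNReal.tsum_mul_left
      _ ≤ D ^ q * (C * ENNReal.ofReal 5 ^ n) *
            (∑' p : w, ∫⁻ y in cube p.1.1 p.1.2.1, G y * U y ^ (1 / q)) ^ q := by
          gcongr
          exact tsum_rpow_le_rpow_tsum _ hq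
      _ ≤ _ := by
          rw [← lintegral_biUnion hcount (fun p _ => measurableSet_cube _ _) hdisj]
          gcongr
          exact Measure.restrict_le_self
  have hset : {x : EuclideanSpace ℝ (Fin n) | x ≠ 0 ∧ ∃ (a : EuclideanSpace ℝ (Fin n)) (l : ℝ),
      0 < l ∧ x ∈ cube a l ∧ 10 * n * l ≤ ‖x‖ ∧ τ * ENNReal.ofReal (‖x‖ ^ β) ≤
        volume (cube a l) ^ δ * ⨍⁻ y in cube a l, G y ∂volume} =
      ⋃ R : ℕ, {x | ‖x‖ ≤ R ∧ ∃ a l, P (a, l, x)} := by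
    ext x
    simp only [Set.mem_iUnion, Set.mem_ofPred_eq]
    constructor
    · rintro ⟨hx, a, l, h⟩
      obtain ⟨R, hR⟩ := exists_nat_ge ‖x‖
      exact ⟨R, hR, a, l, hx, h⟩
    · rintro ⟨R, -, a, l, hx, h⟩
      exact ⟨hx, a, l, h⟩
  -- Along a countable directed union the integral is a supremum, without measurability of the sets.
  have hdir : Directed (· ⊆ ·)
      fun R : ℕ => {x : EuclideanSpace ℝ (Fin n) | ‖x‖ ≤ R ∧ ∃ a l, P (a, l, x)} :=
    Monotone.directed_le fun R S hRS x hx => ⟨hx.1.trans (by exact_mod_cast hRS), hx.2⟩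
  rw [hset, setLIntegral_iUnion_of_directed _ hdir, ENNReal.mul_iSup]
  exact iSup_le bounded

/-! ### Cubes large relative to the distance to the origin. -/

/-- The closed cube centred at the origin with half side length `r`. -/
def centeredCube (n : ℕ) (r : ℝ) : Set (EuclideanSpace ℝ (Fin n)) :=
  cube (WithLp.toLp 2 fun _ => -r) (2 * r)

theorem mem_centeredCube {n : ℕ} {r : ℝ} {x : EuclideanSpace ℝ (Fin n)} :
    x ∈ centeredCube n r ↔ ∀ i, |x i| ≤ r := by
  refine forall_congr' fun i => ?_
  simp only [abs_le]
  constructor <;> rintro ⟨h1, h2⟩ <;> constructor <;> linarith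

theorem centeredCube_mono (n : ℕ) {r s : ℝ} (h : r ≤ s) : centeredCube n r ⊆ centeredCube n s :=
  fun _ hx => mem_centeredCube.2 fun i => (mem_centeredCube.1 hx i).trans h

theorem abs_apply_le_norm {n : ℕ} (x : EuclideanSpace ℝ (Fin n)) (i : Fin n) : |x i| ≤ ‖x‖ :=
  PiLp.norm_apply_le x i

/-- The mass of a decreasing radial power times an `A₁` weight outside a ball is controlled by
the mass of the weight near that ball. -/
theorem A1Bound.lintegral_tail_le {n : ℕ} {U : EuclideanSpace ℝ (Fin n) → ℝ≥0∞} {C : ℝ≥0∞}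
    (hU : A1Bound U C) {β q : ℝ} (hβ : β ≤ 0) (hq : 0 ≤ q) {r : ℝ} (hr : 0 < r) :
    ∫⁻ y in {y : EuclideanSpace ℝ (Fin n) | r ≤ ‖y‖}, U y * ENNReal.ofReal (‖y‖ ^ β) ^ q ≤
      C * (1 - ENNReal.ofReal (2 ^ (β * q + n)))⁻¹ *
        (ENNReal.ofReal (r ^ β) ^ q * ∫⁻ y in centeredCube n (2 * r), U y) := by
  set ρ := ENNReal.ofReal ((2 : ℝ) ^ (β * q + n)) with hρ
  -- Dyadic shells: on the k-th, the power contributes 2^{kβq} and doubling contributes 2^{kn},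
  -- giving the ratio ρ.
  have hcover : {y : EuclideanSpace ℝ (Fin n) | r ≤ ‖y‖} ⊆
      ⋃ k : ℕ, {y | 2 ^ k * r ≤ ‖y‖} ∩ centeredCube n (2 ^ (k + 1) * r) := by
    intro y hy
    obtain ⟨k, hk1, hk2⟩ := exists_nat_pow_near (x := ‖y‖ / r) (y := 2)
      ((one_le_div hr).2 hy) (by norm_num)
    rw [le_div_iff₀ hr] at hk1
    rw [div_lt_iff₀ hr] at hk2
    exact Set.mem_iUnion.2 ⟨k, hk1, mem_centeredCube.2 fun i =>
      (abs_apply_le_norm y i).trans hk2.le⟩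
  have piece : ∀ k : ℕ, ∫⁻ y in {y | 2 ^ k * r ≤ ‖y‖} ∩ centeredCube n (2 ^ (k + 1) * r),
      U y * ENNReal.ofReal (‖y‖ ^ β) ^ q ≤
        C * (ENNReal.ofReal (r ^ β) ^ q * ∫⁻ y in centeredCube n (2 * r), U y) * ρ ^ k := by
    intro k
    have h2k : (1 : ℝ) ≤ 2 ^ k := one_le_pow₀ (by norm_num)
    have hρk : ENNReal.ofReal ((2 ^ k * r) ^ β) ^ q * ENNReal.ofReal (2 ^ k) ^ n =
        ENNReal.ofReal (r ^ β) ^ q * ρ ^ k := by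
      rw [ENNReal.ofReal_rpow_of_nonneg (by positivity) hq,
        ENNReal.ofReal_rpow_of_nonneg (by positivity) hq, hρ,
        ← ENNReal.ofReal_pow (by positivity), ← ENNReal.ofReal_pow (by positivity),
        ← ENNReal.ofReal_mul (by positivity), ← ENNReal.ofReal_mul (by positivity)]
      congr 1
      rw [Real.mul_rpow (by positivity) hr.le, Real.mul_rpow (by positivity) (by positivity),
        Real.rpow_add (by norm_num), Real.rpow_natCast, Real.rpow_mul (by norm_num), mul_pow,
        Real.rpow_pow_comm (x := (2 : ℝ) ^ β) (by positivity),
        Real.rpow_pow_comm (x := (2 : ℝ)) (by positivity)]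
      ring
    refine (setLIntegral_mul_rpow_le U (fun y => ENNReal.ofReal (‖y‖ ^ β))
      (c := ENNReal.ofReal ((2 ^ k * r) ^ β))
      ((measurableSet_le measurable_const measurable_norm).inter (measurableSet_cube _ _))
      Set.inter_subset_right ENNReal.ofReal_ne_top hq fun y hy =>
        ENNReal.ofReal_le_ofReal (Real.rpow_le_rpow_of_nonpos (by positivity) hy.1 hβ)).trans ?_
    have hdoub : ∫⁻ y in centeredCube n (2 ^ (k + 1) * r), U y ≤
        C * ENNReal.ofReal (2 ^ k) ^ n * ∫⁻ y in centeredCube n (2 * r), U y :=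
      hU.lintegral_cube_le (by positivity) (by positivity) (by positivity)
        (centeredCube_mono n (by rw [pow_succ]; nlinarith)) (by rw [pow_succ]; linarith)
    calc _ ≤ ENNReal.ofReal ((2 ^ k * r) ^ β) ^ q *
          (C * ENNReal.ofReal (2 ^ k) ^ n * ∫⁻ y in centeredCube n (2 * r), U y) :=
          mul_le_mul' le_rfl hdoub
      _ = C * (ENNReal.ofReal ((2 ^ k * r) ^ β) ^ q * ENNReal.ofReal (2 ^ k) ^ n) *
          ∫⁻ y in centeredCube n (2 * r), U y := by ring
      _ = _ := by rw [hρk]; ring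
  refine ((lintegral_mono_set hcover).trans (lintegral_iUnion_le _ _)).trans
    ((ENNReal.tsum_le_tsum piece).trans_eq ?_)
  -- If ρ ≥ 1, truncated subtraction makes the factor (1 - ρ)⁻¹ infinite, so no sign condition on βq
  -- + n is needed here.
  rw [ENNReal.tsum_mul_left, ENNReal.tsum_geometric]
  ring

/-- The part of the level set covered by cubes that are large relative to the distance to `0`. -/
theorem A1Bound.lintegral_global_le {n : ℕ} {U : EuclideanSpace ℝ (Fin n) → ℝ≥0∞}
    {C : ℝ≥0∞} (hU : A1Bound U C) {β δ q : ℝ} (hβ : β ≤ 0) (hq : 0 < q) (hδ : δ * q = q - 1)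
    (G : EuclideanSpace ℝ (Fin n) → ℝ≥0∞) (τ : ℝ≥0∞) :
    τ ^ q * ∫⁻ y in {x : EuclideanSpace ℝ (Fin n) | x ≠ 0 ∧ ∃ (a : EuclideanSpace ℝ (Fin n))
        (l : ℝ), 0 < l ∧ x ∈ cube a l ∧ ‖x‖ ≤ 10 * n * l ∧
        τ * ENNReal.ofReal (‖x‖ ^ β) ≤ volume (cube a l) ^ δ * ⨍⁻ y in cube a l, G y ∂volume},
        U y * ENNReal.ofReal (‖y‖ ^ β) ^ q ≤
      C * (1 - ENNReal.ofReal (2 ^ (β * q + n)))⁻¹ * ENNReal.ofReal (2 ^ (-β)) ^ q *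
        (C * ENNReal.ofReal (2 * (20 * n + 1)) ^ n) * (∫⁻ y, G y * U y ^ (1 / q)) ^ q := by
  set E := {x : EuclideanSpace ℝ (Fin n) | x ≠ 0 ∧ ∃ (a : EuclideanSpace ℝ (Fin n))
        (l : ℝ), 0 < l ∧ x ∈ cube a l ∧ ‖x‖ ≤ 10 * n * l ∧
        τ * ENNReal.ofReal (‖x‖ ^ β) ≤ volume (cube a l) ^ δ * ⨍⁻ y in cube a l, G y ∂volume}
    with hE
  set D := ENNReal.ofReal ((2 : ℝ) ^ (-β)) with hD
  set A := C * (1 - ENNReal.ofReal ((2 : ℝ) ^ (β * q + n)))⁻¹ with hA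
  -- One point of E and its witness cube control the mass of the whole exterior of radius r.
  have main : ∀ x ∈ E, ∀ r : ℝ, 0 < r → r ≤ ‖x‖ → ‖x‖ < 2 * r →
      τ ^ q * ∫⁻ y in {y : EuclideanSpace ℝ (Fin n) | r ≤ ‖y‖},
        U y * ENNReal.ofReal (‖y‖ ^ β) ^ q ≤
      A * D ^ q * (C * ENNReal.ofReal (2 * (20 * n + 1)) ^ n) *
        (∫⁻ y, G y * U y ^ (1 / q)) ^ q := by
    rintro x ⟨hx0, a, l, hl, hx, hxl, hτ⟩ r hr hrx hxr
    have hnorm : 0 < ‖x‖ := norm_pos_iff.2 hx0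
    have hnl : 0 ≤ n * l := by positivity
    -- The half side must dominate both 10nl + l, to contain the witness cube, and 2r ≤ 2‖x‖ ≤ 20nl,
    -- to contain the cube from the tail estimate.
    have hsub : cube a l ⊆ centeredCube n ((20 * n + 1) * l) := by
      intro y hy
      refine mem_centeredCube.2 fun i => ?_
      have h1 := hy i
      have h2 := hx i
      have h3 := abs_le.1 (abs_apply_le_norm x i)
      rw [abs_le]
      constructor <;> linarith
    have hsub' : centeredCube n (2 * r) ⊆ centeredCube n ((20 * n + 1) * l) :=
      centeredCube_mono n (by linarith)
    calc τ ^ q * ∫⁻ y in {y : EuclideanSpace ℝ (Fin n) | r ≤ ‖y‖},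
            U y * ENNReal.ofReal (‖y‖ ^ β) ^ q
        ≤ τ ^ q * (A * ((D * ENNReal.ofReal (‖x‖ ^ β)) ^ q *
            ∫⁻ y in centeredCube n ((20 * n + 1) * l), U y)) := by
          gcongr
          refine (hU.lintegral_tail_le hβ hq.le hr).trans ?_
          gcongr
          · exact ofReal_rpow_le_of_half_le hβ hnorm (by linarith)
      _ = A * D ^ q * ((∫⁻ y in centeredCube n ((20 * n + 1) * l), U y) *
            (τ * ENNReal.ofReal (‖x‖ ^ β)) ^ q) := by
          rw [ENNReal.mul_rpow_of_nonneg _ _ hq.le, ENNReal.mul_rpow_of_nonneg _ _ hq.le]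
          ring
      _ ≤ A * D ^ q * ((∫⁻ y in centeredCube n ((20 * n + 1) * l), U y) *
            (volume (cube a l) ^ δ * ⨍⁻ y in cube a l, G y ∂volume) ^ q) := by gcongr
      _ ≤ A * D ^ q * (C * ENNReal.ofReal (2 * (20 * n + 1)) ^ n *
            (∫⁻ y in cube a l, G y * U y ^ (1 / q)) ^ q) := by
          refine mul_le_mul' le_rfl ?_
          exact hU.lintegral_mul_le hq hδ G hl (by positivity) (by positivity) hsub
            (by linarith)
      _ ≤ A * D ^ q * (C * ENNReal.ofReal (2 * (20 * n + 1)) ^ n *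
            (∫⁻ y, G y * U y ^ (1 / q)) ^ q) := by
          gcongr
          exact Measure.restrict_le_self
      _ = _ := by ring
  -- Exponents of the dyadic annuli meeting E. The exteriors are nested, so their union costs a
  -- supremum and not a sum.
  set I : Set ℤ := {m | ∃ x ∈ E, (2 : ℝ) ^ m ≤ ‖x‖ ∧ ‖x‖ < 2 * 2 ^ m} with hI
  have hcover : E ⊆ ⋃ m : I, {y : EuclideanSpace ℝ (Fin n) | (2 : ℝ) ^ (m : ℤ) ≤ ‖y‖} := by
    intro x hx
    obtain ⟨m, h1, h2⟩ := exists_mem_Ico_zpow (norm_pos_iff.2 hx.1) (one_lt_two (α := ℝ))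
    rw [zpow_add_one₀ two_ne_zero, mul_comm] at h2
    exact Set.mem_iUnion.2 ⟨⟨m, x, hx, h1, h2⟩, h1⟩
  have hdir : Directed (· ⊆ ·)
      fun m : I => {y : EuclideanSpace ℝ (Fin n) | (2 : ℝ) ^ (m : ℤ) ≤ ‖y‖} :=
    Antitone.directed_le fun m k hmk y (hy : (2 : ℝ) ^ (k : ℤ) ≤ ‖y‖) =>
      (zpow_le_zpow_right₀ one_le_two hmk).trans hy
  calc _ ≤ τ ^ q * ∫⁻ y in ⋃ m : I, {y : EuclideanSpace ℝ (Fin n) | (2 : ℝ) ^ (m : ℤ) ≤ ‖y‖},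
        U y * ENNReal.ofReal (‖y‖ ^ β) ^ q := by
        gcongr
    _ ≤ _ := by
      rw [setLIntegral_iUnion_of_directed _ hdir, ENNReal.mul_iSup]
      refine iSup_le fun m => ?_
      obtain ⟨x, hx, h1, h2⟩ := m.2
      exact main x hx _ (by positivity) h1 h2

/-! ### Assembly of the two cases. -/

theorem mainTheorem4 (n : ℕ) (γ β q : ℝ) (hγ : 0 < γ) (hγn : γ < (n : ℝ)) (hβ : β < -(n : ℝ))
    (hq : q = (n : ℝ) / ((n : ℝ) - γ)) (u : EuclideanSpace ℝ (Fin n) → ℝ) (hu : IsA1 u) :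
    ∃ C : ℝ, 0 < C ∧ ∀ f : EuclideanSpace ℝ (Fin n) → ℝ,
      AEMeasurable f volume → (∃ K : ℝ, ∀ᵐ x ∂volume, |f x| ≤ K) → ∀ t : ℝ, 0 < t →
        (∫⁻ x in {x : EuclideanSpace ℝ (Fin n) |
              fractionalMaximal γ (fun y => f y * radialPower β y) x /
                ENNReal.ofReal (radialPower β x) > ENNReal.ofReal t},
            ENNReal.ofReal (u x * radialPower β x ^ q) ∂volume) ^ (1 / q) ≤
          ENNReal.ofReal (C / t) *
            ∫⁻ x, ENNReal.ofReal (|f x| * u x ^ (1 / q) * radialPower β x) ∂volume := by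
  have hn0 : (0 : ℝ) < n := hγ.trans hγn
  have hn : 1 ≤ n := by exact_mod_cast hn0
  have hq1 : 1 < q := by rw [hq, one_lt_div (by linarith)]; linarith
  have hq0 : 0 < q := by linarith
  have hδ : γ / n * q = q - 1 := by
    have : (n : ℝ) - γ ≠ 0 := by linarith
    rw [hq]; field_simp; ring
  have hβ0 : β ≤ 0 := by linarith
  obtain ⟨C₀, hU⟩ := hu.exists_a1Bound
  have hupos := hu.1.2
  set U : EuclideanSpace ℝ (Fin n) → ℝ≥0∞ := fun y => ENNReal.ofReal (u y) with hUdef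
  set A : ℝ≥0∞ := ENNReal.ofReal (2 ^ (-β)) ^ q * (C₀ * ENNReal.ofReal 5 ^ n) +
    C₀ * (1 - ENNReal.ofReal (2 ^ (β * q + n)))⁻¹ * ENNReal.ofReal (2 ^ (-β)) ^ q *
        (C₀ * ENNReal.ofReal (2 * (20 * n + 1)) ^ n) with hA
  have hAtop : A ≠ ∞ := by
    -- The decay β < -n enters here: with q > 1 it gives βq + n < 0, so the geometric series
    -- converges.
    have hρ : ENNReal.ofReal ((2 : ℝ) ^ (β * q + n)) < 1 := by
      rw [ENNReal.ofReal_lt_one]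
      exact Real.rpow_lt_one_of_one_lt_of_neg (by norm_num) (by nlinarith)
    have h1 : (1 - ENNReal.ofReal ((2 : ℝ) ^ (β * q + n)))⁻¹ ≠ ∞ :=
      ENNReal.inv_ne_top.2 (tsub_pos_of_lt hρ).ne'
    have h2 : ENNReal.ofReal ((2 : ℝ) ^ (-β)) ^ q ≠ ∞ :=
      ENNReal.rpow_ne_top_of_nonneg hq0.le ENNReal.ofReal_ne_top
    have h3 : ∀ s : ℝ, ENNReal.ofReal s ^ n ≠ ∞ := fun s =>
      ENNReal.pow_ne_top ENNReal.ofReal_ne_top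
    have h4 : ∀ s : ℝ, C₀ * ENNReal.ofReal s ^ n ≠ ∞ := fun s =>
      ENNReal.mul_ne_top ENNReal.coe_ne_top (h3 s)
    exact ENNReal.add_ne_top.2 ⟨ENNReal.mul_ne_top h2 (h4 _), ENNReal.mul_ne_top
      (ENNReal.mul_ne_top (ENNReal.mul_ne_top ENNReal.coe_ne_top h1) h2) (h4 _)⟩
  have hAq : A ^ (1 / q) ≠ ∞ := ENNReal.rpow_ne_top_of_nonneg (by positivity) hAtop
  -- The summand 1 only secures positivity.
  refine ⟨(A ^ (1 / q)).toReal + 1, by positivity, fun f _ _ t ht => ?_⟩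
  set G : EuclideanSpace ℝ (Fin n) → ℝ≥0∞ :=
    fun y => ENNReal.ofReal |f y * radialPower β y| with hG
  have hrad : ∀ y : EuclideanSpace ℝ (Fin n), 0 ≤ radialPower β y := fun y =>
    Real.rpow_nonneg (norm_nonneg y) β
  have hT : ∫⁻ x, ENNReal.ofReal (|f x| * u x ^ (1 / q) * radialPower β x) =
      ∫⁻ y, G y * U y ^ (1 / q) := by
    refine lintegral_congr_ae ?_
    filter_upwards [hupos] with y hy
    rw [hG, hUdef]
    simp only
    rw [ENNReal.ofReal_rpow_of_pos hy, ← ENNReal.ofReal_mul (abs_nonneg _), abs_mul,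
      abs_of_nonneg (hrad y)]
    ring_nf
  have hW : ∀ y, ENNReal.ofReal (u y * radialPower β y ^ q) =
      U y * ENNReal.ofReal (‖y‖ ^ β) ^ q := fun y => by
    rw [ENNReal.ofReal_mul' (Real.rpow_nonneg (hrad y) q),
      ← ENNReal.ofReal_rpow_of_nonneg (hrad y) hq0.le, radialPower]
  simp only [hW, hT]
  set T := ∫⁻ y, G y * U y ^ (1 / q)
  set τ := ENNReal.ofReal t with hτ
  have hτ0 : τ ≠ 0 := by simpa [hτ] using ht
  have hτtop : τ ≠ ∞ := ENNReal.ofReal_ne_top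
  have hlocal := hU.lintegral_local_le hn hβ0 hq1.le hδ G τ
  have hglobal := hU.lintegral_global_le hβ0 hq0 hδ G τ
  set S₁ := {x : EuclideanSpace ℝ (Fin n) | x ≠ 0 ∧ ∃ (a : EuclideanSpace ℝ (Fin n))
        (l : ℝ), 0 < l ∧ x ∈ cube a l ∧ 10 * n * l ≤ ‖x‖ ∧
        τ * ENNReal.ofReal (‖x‖ ^ β) ≤ volume (cube a l) ^ (γ / n) *
          ⨍⁻ y in cube a l, G y ∂volume}
  set S₂ := {x : EuclideanSpace ℝ (Fin n) | x ≠ 0 ∧ ∃ (a : EuclideanSpace ℝ (Fin n))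
        (l : ℝ), 0 < l ∧ x ∈ cube a l ∧ ‖x‖ ≤ 10 * n * l ∧
        τ * ENNReal.ofReal (‖x‖ ^ β) ≤ volume (cube a l) ^ (γ / n) *
          ⨍⁻ y in cube a l, G y ∂volume}
  set S := {x : EuclideanSpace ℝ (Fin n) |
    fractionalMaximal γ (fun y => f y * radialPower β y) x / ENNReal.ofReal (radialPower β x) > τ}
  -- The origin is split off because v(0) is only a convention; it is a null set.
  have hsub : S ⊆ {0} ∪ (S₁ ∪ S₂) := by
    intro x hx
    by_cases hx0 : x = 0
    · exact Or.inl hx0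
    have hpos : 0 < radialPower β x := Real.rpow_pos_of_pos (norm_pos_iff.2 hx0) β
    have hlt : τ * ENNReal.ofReal (‖x‖ ^ β) <
        fractionalMaximal γ (fun y => f y * radialPower β y) x :=
      (ENNReal.lt_div_iff_mul_lt (Or.inl (ENNReal.ofReal_pos.2 hpos).ne')
        (Or.inl ENNReal.ofReal_ne_top)).1 hx
    simp only [fractionalMaximal, lt_iSup_iff] at hlt
    obtain ⟨a, l, hl, hxa, hlt⟩ := hlt
    rcases le_total (10 * n * l) ‖x‖ with h | h
    · exact Or.inr (Or.inl ⟨hx0, a, l, hl, hxa, h, hlt.le⟩)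
    · exact Or.inr (Or.inr ⟨hx0, a, l, hl, hxa, h, hlt.le⟩)
  have : Nontrivial (EuclideanSpace ℝ (Fin n)) := by
    have : Nonempty (Fin n) := ⟨⟨0, hn⟩⟩
    infer_instance
  have hzero : ∫⁻ y in ({0} : Set (EuclideanSpace ℝ (Fin n))),
      U y * ENNReal.ofReal (‖y‖ ^ β) ^ q = 0 :=
    setLIntegral_measure_zero _ _ (measure_singleton _)
  have key : τ ^ q * ∫⁻ y in S, U y * ENNReal.ofReal (‖y‖ ^ β) ^ q ≤ A * T ^ q := by
    calc _ ≤ τ ^ q * ((∫⁻ y in S₁, U y * ENNReal.ofReal (‖y‖ ^ β) ^ q) +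
          ∫⁻ y in S₂, U y * ENNReal.ofReal (‖y‖ ^ β) ^ q) := by
          refine mul_le_mul' le_rfl ?_
          refine ((lintegral_mono_set hsub).trans (lintegral_union_le _ _ _)).trans ?_
          rw [hzero, zero_add]
          exact lintegral_union_le _ _ _
      _ ≤ _ := by
          rw [mul_add, hA, add_mul]
          exact add_le_add hlocal hglobal
  have hroot : τ * (∫⁻ y in S, U y * ENNReal.ofReal (‖y‖ ^ β) ^ q) ^ (1 / q) ≤
      A ^ (1 / q) * T := by
    have h := ENNReal.rpow_le_rpow key (z := 1 / q) (by positivity)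
    rwa [ENNReal.mul_rpow_of_nonneg _ _ (by positivity),
      ENNReal.mul_rpow_of_nonneg _ _ (by positivity), ← ENNReal.rpow_mul, ← ENNReal.rpow_mul,
      mul_one_div_cancel hq0.ne', ENNReal.rpow_one, ENNReal.rpow_one] at h
  calc _ ≤ A ^ (1 / q) * T / τ := by
        rw [ENNReal.le_div_iff_mul_le (Or.inl hτ0) (Or.inl hτtop), mul_comm]
        exact hroot
    _ = A ^ (1 / q) / τ * T := by rw [ENNReal.mul_div_right_comm]
    _ ≤ _ := by
        rw [ENNReal.ofReal_div_of_pos ht]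
        gcongr
        rw [← ENNReal.ofReal_toReal hAq]
        exact ENNReal.ofReal_le_ofReal (by simp)
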